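/- **Setting.** There are finite sets $M$ of machines and $J$ of jobs; job $j$ has size $p_j\ge 0$, which is also its weight, and each machine $i$ has a set $J_i\subseteq J$ of jobs that it can process (the processing time of $j$ on $i$ is $p_j$ if $j\in J_i$ and $\infty$ otherwise). A configuration is a set of jobs, with cost (weighted sum of completion times on one machine) $$\mathrm{cost}(C)=\sum_{j\in C}p_j^2+\sum_{\substack{j,j'\in C\\ j\ne j'}}\frac{p_jp_{j'}}2 ,$$ the second sum being over ordered pairs. A feasible solution of the Configuration-LP consists of numbers $y_{iC}\ge 0$ ($i\in M$, $C\subseteq J_i$) with $\sum_{C\subseteq J_i}y_{iC}\le 1$ for every machine $i$ and $\sum_{i}\sum_{C\subseteq J_i,\,C\ni j}y_{iC}=1$ for every job $j$. **Shmoys–Tardos rounding.** Put $x_{ij}=\sum_{C\subseteq J_i,\,C\ni j}y_{iC}$ and give machine $i$ the buckets $u_{i,1},\dots,u_{i,k_i}$, where $k_i=\lceil\sum_j x_{ij}\rceil$. For each machine $i$, starting with $t=1$ and $z=0$, go through all jobs $j$ in an order of non-increasing size (ties broken arbitrarily): if $x_{ij}+\sum_{j'}z_{u_{i,t}j'}\le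 1$, set $z_{u_{i,t}j}=x_{ij}$; otherwise set $z_{u_{i,t}j}=1-\sum_{j'}z_{u_{i,t}j'}$, increase $t$ by one, and set $z_{u_{i,t}j}=x_{ij}-z_{u_{i,t-1}j}$. Write the resulting fractional matching between buckets and jobs in any way as a convex combination $z=\sum_k\lambda_k z_k$ of integral matchings of the complete bipartite graph between buckets and jobs, choose $z_k$ with probability $\lambda_k$, and schedule on machine $i$ the jobs that the chosen matching matches to a bucket of $i$. **Theorem 3.** Fix a machine $i$. Let $y^{\mathrm{in}}$ be the distribution on configurations in which $C\subseteq J_i$ has probability $y_{iC}$ (the missing probability $1-\sum_{C\subseteq J_i} y_{iC}$, if any, being added to the empty configuration), and let $y^{\mathrm{out}}$ be the distribution of the set of jobs that the rounding schedules on $i$. Then $$\sum_C y^{\mathrm{out}}_C\,\mathrm{cost}(C)\ \le\ \frac{1+\sqrt2}{2}\,\sum_C y^{\mathrm{in}}_C\,\mathrm{cost}(C).$$ -/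

import Mathlib

namespace UniformSmith

/-- An instance of scheduling on unrelated machines with uniform Smith ratios: job `j` has size and
weight `p j`, its processing time on machine `i` is `p j` if `j ∈ eligible i` and infinite
otherwise. -/
structure SchedInstance (M J : Type*) where
  p : J → ℝ
  p_nonneg : ∀ j, 0 ≤ p j
  eligible : M → Finset J

variable {M J : Type*} [Fintype M] [Fintype J] [DecidableEq J]

/-- The weighted sum of completion times of the configuration `C` on one machine; the second sum is
over ordered pairs of distinct jobs. -/
noncomputable def cost (I : SchedInstance M J) (C : Finset J) : ℝ :=
  ∑ j ∈ C, I.p j ^ 2 + ∑ j ∈ C, ∑ j' ∈ C.erase j, I.p j * I.p j' / 2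

/-- The marginal `x i j`: the total `y`-value of the configurations of `i` that contain `j`. -/
noncomputable def marginal (I : SchedInstance M J) (y : M → Finset J → ℝ) (i : M) (j : J) : ℝ :=
  ∑ C ∈ (I.eligible i).powerset with j ∈ C, y i C

/-- Feasible solutions of the Configuration-LP. Only the values `y i C` with `C ⊆ eligible i` are
variables of the LP; the other values of `y` are never used. -/
structure IsConfigLPSolution (I : SchedInstance M J) (y : M → Finset J → ℝ) : Prop where
  nonneg : ∀ i, ∀ C ⊆ I.eligible i, 0 ≤ y i C
  machine : ∀ i, ∑ C ∈ (I.eligible i).powerset, y i C ≤ 1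
  job : ∀ j, ∑ i, marginal I y i j = 1

/-- The input distribution on configurations of machine `i`: the LP values, the probability that is
possibly missing being given to the empty configuration (whose cost is `0`). -/
noncomputable def inputDist (I : SchedInstance M J) (y : M → Finset J → ℝ) (i : M)
    (C : Finset J) : ℝ :=
  (if C ⊆ I.eligible i then y i C else 0) +
    (if C = ∅ then 1 - ∑ C' ∈ (I.eligible i).powerset, y i C' else 0)

/-- The number of buckets of machine `i`. -/
noncomputable def numBuckets (I : SchedInstance M J) (y : M → Finset J → ℝ) (i : M) : ℕ :=
  ⌈∑ j, marginal I y i j⌉₊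

/-- The bucket vertices of the bipartite graph; the other side consists of the jobs, and the graph is
complete bipartite. Buckets are numbered from `0`. -/
abbrev Bucket (I : SchedInstance M J) (y : M → Finset J → ℝ) : Type _ :=
  Σ i : M, Fin (numBuckets I y i)

/-- One step of the filling procedure of a machine with marginals `x`: the state consists of the
current bucket and of the matching values set so far. Job `j` is put into the current bucket `t` if
it fits there; otherwise it fills up bucket `t` and its remainder goes to bucket `t + 1`, which
becomes the current one. -/
noncomputable def fillStep (x : J → ℝ) (s : ℕ × (ℕ → J → ℝ)) (j : J) : ℕ × (ℕ → J → ℝ) :=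
  if x j + ∑ j', s.2 s.1 j' ≤ 1 then
    (s.1, Function.update s.2 s.1 (Function.update (s.2 s.1) j (x j)))
  else
    (s.1 + 1,
      Function.update
        (Function.update s.2 s.1 (Function.update (s.2 s.1) j (1 - ∑ j', s.2 s.1 j')))
        (s.1 + 1) (Function.update (s.2 (s.1 + 1)) j (x j - (1 - ∑ j', s.2 s.1 j'))))

/-- The matching values of one machine after the jobs were processed in the order of the list `L`,
starting with the first bucket and all values `0`. -/
noncomputable def fillBuckets (x : J → ℝ) (L : List J) : ℕ → J → ℝ :=
  (L.foldl (fillStep x) (0, fun _ _ => 0)).2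

/-- `L` lists every job exactly once, in non-increasing order of the sizes. -/
structure IsSizeOrder (I : SchedInstance M J) (L : List J) : Prop where
  nodup : L.Nodup
  complete : ∀ j, j ∈ L
  sorted : L.Pairwise (fun j j' => I.p j' ≤ I.p j)

/-- The fractional matching built by the rounding algorithm; `L i` is the order in which the jobs are
processed for machine `i`. -/
noncomputable def fracMatching (I : SchedInstance M J) (y : M → Finset J → ℝ) (L : M → List J)
    (u : Bucket I y) (j : J) : ℝ :=
  fillBuckets (marginal I y u.1) (L u.1) u.2 j

/-- Integral matchings of the complete bipartite graph between `B` and `J`, as `0`/`1` vectors on its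
edges. -/
structure IsIntegralMatching {B J : Type*} [Fintype B] [Fintype J] (m : B → J → ℝ) : Prop where
  zero_or_one : ∀ u j, m u j = 0 ∨ m u j = 1
  left : ∀ u, ∑ j, m u j ≤ 1
  right : ∀ j, ∑ u, m u j ≤ 1

/-- `z = ∑ k, lam k • m k` is a convex combination of integral matchings. -/
structure IsMatchingDecomposition {B J : Type*} [Fintype B] [Fintype J] (z : B → J → ℝ) {K : ℕ}
    (lam : Fin K → ℝ) (m : Fin K → B → J → ℝ) : Prop where
  nonneg : ∀ k, 0 ≤ lam k
  sum_eq_one : ∑ k, lam k = 1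
  matching : ∀ k, IsIntegralMatching (m k)
  combination : ∀ u j, z u j = ∑ k, lam k * m k u j

open Classical in
/-- The set of jobs scheduled on machine `i` when the matching `m` is sampled. -/
noncomputable def assignedJobs {I : SchedInstance M J} {y : M → Finset J → ℝ}
    (m : Bucket I y → J → ℝ) (i : M) : Finset J :=
  {j | ∃ t : Fin (numBuckets I y i), m ⟨i, t⟩ j = 1}

/-- The output distribution on configurations of machine `i`: the probability that `C` is the set of
jobs scheduled on `i`, when the matching `m k` is sampled with probability `lam k`. -/
noncomputable def outputDist {I : SchedInstance M J} {y : M → Finset J → ℝ} {K : ℕ}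
    (lam : Fin K → ℝ) (m : Fin K → Bucket I y → J → ℝ) (i : M) (C : Finset J) : ℝ :=
  ∑ k, if assignedJobs (m k) i = C then lam k else 0

end UniformSmith

/-! ### The extremal inequality for a shifted nonnegative random variable. -/

namespace UniformSmith

/-! Twice the cost of a configuration is its squared load plus the sum of its squared sizes. The
second part is controlled by the marginals `x`, so the point is to compare second moments of the
load.

Output: each bucket holds jobs no larger than those of the bucket before it. Telescoping over the
buckets therefore writes the load as `b + D` with `b` constant and `0 ≤ D ≤` the size matched to the
first bucket. Hence `E[h(D)] ≤ ∑ x_j h(p_j)` for monotone `h` with `h 0 = 0` (`exists_excess`).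

Input: for every `w ≥ 0` the second moment of the load is at least `2w ∑ x_j p_j - w² + ∑ x_j
max(p_j - w, 0)²` (`marginals_le_two_mul_input_cost`). Choose `w` with `E[max(D, w)] = b + E[D]`. In
terms of the output this bound then reads `E[max(D, w)²]`.

What remains, with `c = (1 + √2)/2`, is `E[(b + D)²] ≤ c E[max(D, w)²] + (c - 1) E[D²]`
(`exists_second_moment_bound`). The last term is paid by the sum of squared sizes, which enters the
output bound with factor `1` and the input bound with factor `c`. Equality holds when `b = w/√2` and
`D` is `0` with probability `1/√2` and `(1 + √2) b` otherwise. -/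

theorem two_point_quadratic_nonneg {d w b q : ℝ} (hd : 0 < d) (hd2 : d ^ 2 + 2 * d = 1)
    (hw : 0 ≤ w) (hb : 0 ≤ b) (hbq : b ≤ w * q) (hdb : d * w ≤ b) :
    0 ≤ d * q * w ^ 2 + (1 - d / 2 - 2 * q) * w * b + (1 - (1 - q) * (2 + d)) * b ^ 2 := by
  rcases hw.eq_or_lt with rfl | hw
  · have : b = 0 := le_antisymm (by linarith) hb
    simp [this]
  have hcoef : 0 ≤ d * w ^ 2 - 2 * w * b + (2 + d) * b ^ 2 := by
    have : d * w ^ 2 - 2 * w * b + (2 + d) * b ^ 2 = (2 + d) * (d * w - b) ^ 2 := by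
      linear_combination (-(d * w ^ 2) + 2 * w * b) * hd2
    rw [this]; positivity
  have h1 := mul_nonneg (sub_nonneg.2 hbq) hcoef
  have h2 : 0 ≤ (2 + d) * b * (b - (1 + d) / 2 * w) ^ 2 := by positivity
  refine nonneg_of_mul_nonneg_right (?_ : 0 ≤ w * _) hw
  -- The expression is affine in `q`: at the extreme value `q = b / w` it is a multiple of a square,
  -- and its slope is `(2 + d) (d w - b)²`.
  have key : w * (d * q * w ^ 2 + (1 - d / 2 - 2 * q) * w * b
        + (1 - (1 - q) * (2 + d)) * b ^ 2)
      = (w * q - b) * (d * w ^ 2 - 2 * w * b + (2 + d) * b ^ 2)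
        + (2 + d) * b * (b - (1 + d) / 2 * w) ^ 2 := by
    have h3 : d ^ 3 = d - 2 * (1 - 2 * d) := by
      linear_combination (d - 2) * hd2
    have h2 : d ^ 2 = 1 - 2 * d := by linarith
    ring_nf
    rw [h3, h2]
    ring
  rw [key]; linarith

/-- The numerical inequality behind the factor `(1 + √2) / 2`, for a variable `D` with truncated
moments `q = P(D < w)`, `e = E[D; D < w]`, `V = E[D²; D < w]`, `f = E[D; D ≥ w]` and
`U = E[D²; D ≥ w]`. -/
theorem truncated_moments_inequality {c w b q e f U V : ℝ} (hc : c = (1 + √2) / 2)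
    (hw : 0 ≤ w) (he : 0 ≤ e) (hV : V ≤ w * e) (hb : b = w * q - e)
    (hb0 : 0 ≤ b) (hf : w * (1 - q) ≤ f) (hU : ∀ t, 2 * t * f - t ^ 2 * (1 - q) ≤ U) :
    b ^ 2 + 2 * b * (e + f) + (U + V) ≤
      c * (2 * w * (b + (e + f)) - w ^ 2) + c * (U - 2 * w * f + w ^ 2 * (1 - q))
        + (c - 1) * (U + V) := by
  have hs : √2 ^ 2 = 2 := Real.sq_sqrt (by norm_num)
  have hs1 : 1 < √2 := by
    rw [Real.lt_sqrt (by norm_num)]; norm_num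
  -- With this `d`, `c = 1 + d / 2` and `1 / d = 2 + d`.
  obtain ⟨d, hdef⟩ : ∃ d, d = √2 - 1 := ⟨_, rfl⟩
  have hd : 0 < d := by linarith
  have hd2 : d ^ 2 + 2 * d = 1 := by rw [hdef]; linarith [hs]
  have hd3 : d < 1 / 2 := by nlinarith
  have hcd : c = 1 + d / 2 := by rw [hc, hdef]; ring
  have hV' := mul_le_mul_of_nonneg_left hV (by linarith : (0 : ℝ) ≤ 1 - d / 2)
  have main : 0 ≤ d * w ^ 2 * q + (1 - d / 2) * w * b + d * U + b ^ 2
      - 2 * b * w * q - 2 * b * f := by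
    -- The minimum of `d D² - 2 b D` is at `D = b / d = (2 + d) b`. If that point is at least `w`,
    -- use the tangent there; otherwise the constraint `D ≥ w` binds and the tangent at `w` is used.
    rcases le_total (d * w) b with h | h
    · have h1 := two_point_quadratic_nonneg (q := q) hd hd2 hw hb0 (by linarith) h
      have h2 := mul_le_mul_of_nonneg_left (hU ((2 + d) * b)) hd.le
      have h3 : d * (2 * ((2 + d) * b) * f - ((2 + d) * b) ^ 2 * (1 - q))
          = 2 * b * f - (2 + d) * b ^ 2 * (1 - q) := by
        linear_combination (2 * b * f - (2 + d) * b ^ 2 * (1 - q)) * hd2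
      rw [h3] at h2
      linarith
    · have h1 := mul_le_mul_of_nonneg_left (hU w) hd.le
      have h2 := mul_le_mul_of_nonneg_left hf (by linarith : 0 ≤ 2 * (d * w - b))
      have h3 : 0 ≤ d * w ^ 2 - (1 + d / 2) * w * b + b ^ 2 := by
        have h4 : d * w ^ 2 - (1 + d / 2) * w * b + b ^ 2
            = (b - (1 + d / 2) / 2 * w) ^ 2 + (7 * d / 8 - 5 / 16) * w ^ 2 := by
          linear_combination (-(w ^ 2) / 16) * hd2
        have h5 : (2 : ℝ) / 5 ≤ d := by nlinarith
        have h6 : 0 ≤ (7 * d / 8 - 5 / 16) * w ^ 2 :=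
          mul_nonneg (by linarith) (sq_nonneg w)
        rw [h4]; nlinarith [sq_nonneg (b - (1 + d / 2) / 2 * w)]
      nlinarith
  rw [hcd]
  have he' : e = w * q - b := by linarith
  subst he'
  nlinarith

/-- Raising `D` to the level `w` adds exactly the mean `b`. The added mean is continuous in `w`,
vanishes at `0`, and is at least `b` at `b + ∑ D`. -/
theorem exists_water_level {ι : Type*} [Fintype ι] {lam D : ι → ℝ} {b : ℝ}
    (hlam : ∀ k, 0 ≤ lam k) (hsum : ∑ k, lam k = 1) (hD : ∀ k, 0 ≤ D k) (hb : 0 ≤ b) :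
    ∃ w, 0 ≤ w ∧ ∑ k, lam k * max (w - D k) 0 = b := by
  have hS : 0 ≤ ∑ k, D k := Finset.sum_nonneg fun k _ => hD k
  have hcont : Continuous fun w : ℝ => ∑ k, lam k * max (w - D k) 0 := by fun_prop
  have h0 : ∑ k, lam k * max (0 - D k) 0 = 0 :=
    Finset.sum_eq_zero fun k _ => by rw [max_eq_right (by linarith [hD k]), mul_zero]
  have h1 : b ≤ ∑ k, lam k * max ((b + ∑ k, D k) - D k) 0 := by
    calc b = ∑ k, lam k * b := by rw [← Finset.sum_mul, hsum, one_mul]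
      _ ≤ _ := Finset.sum_le_sum fun k _ => mul_le_mul_of_nonneg_left
        (le_max_of_le_left (by
          linarith [Finset.single_le_sum (fun k _ => hD k) (Finset.mem_univ k)])) (hlam k)
  obtain ⟨w, hw, hwb⟩ := intermediate_value_Icc (by linarith : (0 : ℝ) ≤ b + ∑ k, D k)
    hcont.continuousOn ⟨h0.le.trans hb, h1⟩
  exact ⟨w, hw.1, hwb⟩

/-- At the water level `w`, `max(D, w)` has the same mean as `b + D`, and the terms multiplied by
`c` add up to its second moment. -/
theorem exists_second_moment_bound {ι : Type*} [Fintype ι] {lam D : ι → ℝ} {b c : ℝ}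
    (hc : c = (1 + √2) / 2) (hlam : ∀ k, 0 ≤ lam k) (hsum : ∑ k, lam k = 1)
    (hD : ∀ k, 0 ≤ D k) (hb : 0 ≤ b) :
    ∃ w, 0 ≤ w ∧ ∑ k, lam k * (b + D k) ^ 2 ≤
      c * (2 * w * ∑ k, lam k * (b + D k) - w ^ 2) + c * ∑ k, lam k * max (D k - w) 0 ^ 2
        + (c - 1) * ∑ k, lam k * D k ^ 2 := by
  obtain ⟨w, hw, hwb⟩ := exists_water_level hlam hsum hD hb
  refine ⟨w, hw, ?_⟩
  let s : ι → ℝ := fun k => if D k < w then 1 else 0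
  have hs : ∀ k, (D k < w ∧ s k = 1) ∨ (w ≤ D k ∧ s k = 0) := fun k => by
    by_cases h : D k < w
    · exact .inl ⟨h, if_pos h⟩
    · exact .inr ⟨not_lt.1 h, if_neg h⟩
  have hadd : ∀ F : ι → ℝ, ∑ k, lam k * F k
      = ∑ k, lam k * (s k * F k) + ∑ k, lam k * ((1 - s k) * F k) := fun F => by
    rw [← Finset.sum_add_distrib]
    exact Finset.sum_congr rfl fun k _ => by ring
  have hmono : ∀ F G : ι → ℝ, (∀ k, F k ≤ G k) → ∑ k, lam k * F k ≤ ∑ k, lam k * G k :=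
    fun F G h => Finset.sum_le_sum fun k _ => mul_le_mul_of_nonneg_left (h k) (hlam k)
  have hlin : ∀ (x y z : ℝ) (F G : ι → ℝ), ∑ k, lam k * (x + y * F k + z * G k)
      = x + y * ∑ k, lam k * F k + z * ∑ k, lam k * G k := fun x y z F G => by
    rw [Finset.mul_sum, Finset.mul_sum]
    nth_rw 2 [← one_mul x]
    rw [← hsum, Finset.sum_mul, ← Finset.sum_add_distrib, ← Finset.sum_add_distrib]
    exact Finset.sum_congr rfl fun k _ => by ring
  have hlin0 : ∀ (x y z u : ℝ) (F G H : ι → ℝ),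
      ∑ k, lam k * (x + y * F k + z * G k + u * H k)
      = x + y * ∑ k, lam k * F k + z * ∑ k, lam k * G k + u * ∑ k, lam k * H k :=
    fun x y z u F G H => by
    rw [← hlin x y z F G, Finset.mul_sum, ← Finset.sum_add_distrib]
    exact Finset.sum_congr rfl fun k _ => by ring
  have he : 0 ≤ ∑ k, lam k * (s k * D k) := Finset.sum_nonneg fun k _ =>
    mul_nonneg (hlam k) (mul_nonneg (by rcases hs k with h | h <;> norm_num [h.2]) (hD k))
  have hV : ∑ k, lam k * (s k * D k ^ 2) ≤ w * ∑ k, lam k * (s k * D k) := by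
    have := hmono (fun k => s k * D k ^ 2) (fun k => 0 + w * (s k * D k) + 0 * 0) (fun k => by
      rcases hs k with h | h <;> simp only [h.2]
      · nlinarith [hD k, h.1]
      · simp)
    rw [hlin 0 w 0 (fun k => s k * D k) (fun _ => 0)] at this
    linarith
  have hbe : b = w * ∑ k, lam k * s k - ∑ k, lam k * (s k * D k) := by
    have := hlin 0 w (-1) s (fun k => s k * D k)
    rw [← hwb]
    calc _ = ∑ k, lam k * (0 + w * s k + -1 * (s k * D k)) :=
          Finset.sum_congr rfl fun k _ => by
            rcases hs k with h | h <;> rw [h.2]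
            · rw [max_eq_left (by linarith)]; ring
            · rw [max_eq_right (by linarith)]; ring
      _ = _ := by rw [this]; ring
  have hf : w * (1 - ∑ k, lam k * s k) ≤ ∑ k, lam k * ((1 - s k) * D k) := by
    have := hmono (fun k => w + -w * s k + 0 * 0) (fun k => (1 - s k) * D k) (fun k => by
      rcases hs k with h | h <;> simp only [h.2] <;> linarith)
    rw [hlin w (-w) 0 s (fun _ => 0)] at this
    linarith
  have hU : ∀ t, 2 * t * ∑ k, lam k * ((1 - s k) * D k) - t ^ 2 * (1 - ∑ k, lam k * s k)
      ≤ ∑ k, lam k * ((1 - s k) * D k ^ 2) := fun t => by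
    have := hmono (fun k => -t ^ 2 + t ^ 2 * s k + 2 * t * ((1 - s k) * D k))
      (fun k => (1 - s k) * D k ^ 2) (fun k => by
        rcases hs k with h | h <;> simp only [h.2]
        · linarith
        · nlinarith [sq_nonneg (D k - t)])
    rw [hlin] at this
    linarith
  have hP : ∑ k, lam k * max (D k - w) 0 ^ 2 = ∑ k, lam k * ((1 - s k) * D k ^ 2)
      - 2 * w * ∑ k, lam k * ((1 - s k) * D k) + w ^ 2 * (1 - ∑ k, lam k * s k) := by
    have := hlin0 (w ^ 2) (-w ^ 2) (-2 * w) 1 s (fun k => (1 - s k) * D k)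
      (fun k => (1 - s k) * D k ^ 2)
    calc _ = ∑ k, lam k * (w ^ 2 + -w ^ 2 * s k + -2 * w * ((1 - s k) * D k)
          + 1 * ((1 - s k) * D k ^ 2)) :=
          Finset.sum_congr rfl fun k _ => by
            rcases hs k with h | h <;> rw [h.2]
            · rw [max_eq_right (by linarith [h.1])]; ring
            · rw [max_eq_left (by linarith)]; ring
      _ = _ := by rw [this]; ring
  have h1 : ∑ k, lam k * (b + D k) = b + ∑ k, lam k * D k := by
    have := hlin b 1 0 D (fun _ => 0)
    simpa using this
  have h2 : ∑ k, lam k * (b + D k) ^ 2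
      = b ^ 2 + 2 * b * ∑ k, lam k * D k + ∑ k, lam k * D k ^ 2 := by
    have := hlin (b ^ 2) (2 * b) 1 D (fun k => D k ^ 2)
    rw [one_mul] at this
    rw [← this]
    exact Finset.sum_congr rfl fun k _ => by ring
  rw [h1, h2, hP, hadd D, hadd fun k => D k ^ 2]
  have := truncated_moments_inequality hc hw he hV hbe hb hf hU
  linarith

end UniformSmith
-- The filling procedure and the size bounds of its buckets.
namespace UniformSmith

variable {J : Type*} [Fintype J]

/-- The invariant of the filling procedure: `a` bounds the sizes in bucket `s` from above by `a s`
and, as long as `s` precedes the current bucket, from below by `a (s + 1)`; `l` lists the jobs that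
are still to be processed. -/
structure FillInvariant (p x : J → ℝ) (l : List J) (s : ℕ × (ℕ → J → ℝ)) (a : ℕ → ℝ) : Prop where
  future : ∀ u, s.1 < u → ∀ j, s.2 u j = 0
  full : ∀ u, u < s.1 → ∑ j, s.2 u j = 1
  current : ∑ j, s.2 s.1 j ≤ 1
  column : ∀ j n, ∑ u ∈ Finset.range n, s.2 u j ≤ x j
  upper : ∀ u j, s.2 u j ≠ 0 → p j ≤ a u
  lower : ∀ u, u < s.1 → ∀ j, s.2 u j ≠ 0 → a (u + 1) ≤ p j
  unprocessed : ∀ j ∈ l, ∀ u, s.2 u j = 0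
  unprocessed_le : ∀ j ∈ l, p j ≤ a s.1
  unprocessed_le_current : ∀ j ∈ l, ∀ j', s.2 s.1 j' ≠ 0 → p j ≤ p j'
  bound_nonneg : ∀ u, 0 ≤ a u

/-- Nothing is placed yet, so any common upper bound on the sizes can serve as `a`. -/
theorem FillInvariant.initial {p x : J → ℝ} (hp : ∀ j, 0 ≤ p j) (hx : ∀ j, 0 ≤ x j) (l : List J) :
    FillInvariant p x l (0, fun _ _ => 0) (fun _ => ∑ j, p j) where
  future _ _ _ := rfl
  full u hu := absurd hu (Nat.not_lt_zero u)
  current := by simp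
  column j n := by simpa using hx j
  upper u j h := absurd rfl h
  lower u j _ h := absurd rfl h
  unprocessed _ _ _ := rfl
  unprocessed_le j _ := Finset.single_le_sum (fun j _ => hp j) (Finset.mem_univ j)
  unprocessed_le_current j _ j' h := absurd rfl h
  bound_nonneg _ := Finset.sum_nonneg fun j _ => hp j

variable [DecidableEq J]

theorem sum_update_of_eq_zero {f : J → ℝ} {j : J} (h : f j = 0) (v : ℝ) :
    ∑ j', Function.update f j v j' = v + ∑ j', f j' := by
  rw [Finset.sum_update_of_mem (Finset.mem_univ j),
    ← Finset.add_sum_erase _ f (Finset.mem_univ j), h, zero_add, Finset.sdiff_singleton_eq_erase]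

theorem FillInvariant.step {p x : J → ℝ} (hp : ∀ j, 0 ≤ p j) (hx : ∀ j, 0 ≤ x j)
    (hx1 : ∀ j, x j ≤ 1) {j : J} {l : List J} (hj : j ∉ l) (hl : ∀ j' ∈ l, p j' ≤ p j)
    {s : ℕ × (ℕ → J → ℝ)} {a : ℕ → ℝ} (h : FillInvariant p x (j :: l) s a) :
    ∃ a', FillInvariant p x l (fillStep x s j) a' := by
  obtain ⟨t, z⟩ := s
  have hzj : ∀ u, z u j = 0 := h.unprocessed j (by simp)
  have hcur : ∑ j', z t j' ≤ 1 := h.current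
  have hne : ∀ j' ∈ l, j' ≠ j := fun j' hj' e => hj (e ▸ hj')
  by_cases hfit : x j + ∑ j', z t j' ≤ 1
  · refine ⟨a, ?_⟩
    have hstep : fillStep x (t, z) j
        = (t, Function.update z t (Function.update (z t) j (x j))) := if_pos hfit
    rw [hstep]
    obtain ⟨z', hz'⟩ : ∃ z', z' = Function.update z t (Function.update (z t) j (x j)) := ⟨_, rfl⟩
    rw [← hz']
    have hrow : z' t = Function.update (z t) j (x j) := by rw [hz', Function.update_self]
    have hrow' : ∀ u, u ≠ t → z' u = z u := fun u hu => by rw [hz', Function.update_of_ne hu]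
    have hcol : ∀ u j', j' ≠ j → z' u j' = z u j' := fun u j' hj' => by
      rcases eq_or_ne u t with rfl | hu
      · rw [hrow, Function.update_of_ne hj']
      · rw [hrow' u hu]
    have hcolj : ∀ u, z' u j = if u = t then x j else 0 := fun u => by
      split_ifs with hu
      · rw [hu, hrow, Function.update_self]
      · rw [hrow' u hu, hzj]
    constructor
    · intro u hu j'
      dsimp only at hu ⊢
      rw [hrow' u hu.ne']; exact h.future u hu j'
    · intro u hu
      dsimp only at hu ⊢
      rw [hrow' u hu.ne]; exact h.full u hu
    · dsimp only
      rw [hrow, sum_update_of_eq_zero (hzj t)]; exact hfit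
    · intro j' n
      dsimp only
      rcases eq_or_ne j' j with rfl | hj'
      · simp only [hcolj, Finset.sum_ite_eq']
        split_ifs; exacts [le_rfl, hx _]
      · simp only [hcol _ j' hj']; exact h.column j' n
    · intro u j' hz
      dsimp only at hz
      rcases eq_or_ne j' j with rfl | hj'
      · rw [hcolj] at hz
        have : u = t := by by_contra hu; exact hz (if_neg hu)
        rw [this]; exact h.unprocessed_le j' (by simp)
      · rw [hcol u j' hj'] at hz; exact h.upper u j' hz
    · intro u hu j' hz
      dsimp only at hu hz
      rw [hrow' u hu.ne] at hz; exact h.lower u hu j' hz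
    · intro j' hj' u
      dsimp only
      rw [hcol u j' (hne j' hj')]; exact h.unprocessed j' (by simp [hj']) u
    · intro j' hj'
      exact h.unprocessed_le j' (by simp [hj'])
    · intro j' hj' i hz
      dsimp only at hz
      rcases eq_or_ne i j with rfl | hi
      · exact hl j' hj'
      · rw [hcol t i hi] at hz
        exact h.unprocessed_le_current j' (by simp [hj']) i hz
    · exact h.bound_nonneg
  -- The overflowing job is a smallest one of bucket `t` and a largest one of bucket `t + 1`, so its
  -- size separates the two.
  · refine ⟨Function.update a (t + 1) (p j), ?_⟩
    obtain ⟨A, hA⟩ : ∃ A, A = 1 - ∑ j', z t j' := ⟨_, rfl⟩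
    obtain ⟨z', hz'⟩ : ∃ z', z' = Function.update (Function.update z t
      (Function.update (z t) j A)) (t + 1) (Function.update (z (t + 1)) j (x j - A)) := ⟨_, rfl⟩
    have hstep : fillStep x (t, z) j = (t + 1, z') := by rw [hz', hA]; exact if_neg hfit
    rw [hstep]
    have hA0 : 0 ≤ A := by linarith
    have hAx : 0 ≤ x j - A := by linarith [not_le.1 hfit]
    have hrow1 : z' (t + 1) = Function.update (z (t + 1)) j (x j - A) := by
      rw [hz', Function.update_self]
    have hrow : z' t = Function.update (z t) j A := by
      rw [hz', Function.update_of_ne (by omega), Function.update_self]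
    have hrow' : ∀ u, u ≠ t → u ≠ t + 1 → z' u = z u := fun u hu hu1 => by
      rw [hz', Function.update_of_ne hu1, Function.update_of_ne hu]
    have hcol : ∀ u j', j' ≠ j → z' u j' = z u j' := fun u j' hj' => by
      rcases eq_or_ne u t with rfl | hu
      · rw [hrow, Function.update_of_ne hj']
      · rcases eq_or_ne u (t + 1) with rfl | hu1
        · rw [hrow1, Function.update_of_ne hj']
        · rw [hrow' u hu hu1]
    have hcolj : ∀ u, z' u j = (if u = t then A else 0) + if u = t + 1 then x j - A else 0 :=
      fun u => by
      rcases eq_or_ne u t with rfl | hu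
      · rw [hrow, Function.update_self]; simp
      · rcases eq_or_ne u (t + 1) with rfl | hu1
        · rw [hrow1, Function.update_self]; simp
        · rw [hrow' u hu hu1, hzj]; simp [hu, hu1]
    have hfut : ∀ j', z (t + 1) j' = 0 := h.future (t + 1) (Nat.lt_succ_self t)
    have haj : p j ≤ a t := h.unprocessed_le j (by simp)
    constructor
    · intro u hu j'
      dsimp only at hu ⊢
      rw [hrow' u (by omega) (by omega)]; exact h.future u (by dsimp only; omega) j'
    · intro u hu
      dsimp only at hu ⊢
      rcases eq_or_ne u t with rfl | hut
      · rw [hrow, sum_update_of_eq_zero (hzj u), hA]; ring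
      · rw [hrow' u hut (by omega)]; exact h.full u (by dsimp only; omega)
    · dsimp only
      rw [hrow1, sum_update_of_eq_zero (hzj _), Finset.sum_eq_zero fun j' _ => hfut j']
      -- `x j ≤ 1` ensures that the remainder fits into a single new bucket.
      linarith [hx1 j]
    · intro j' n
      dsimp only
      rcases eq_or_ne j' j with rfl | hj'
      · simp only [hcolj, Finset.sum_add_distrib, Finset.sum_ite_eq']
        split_ifs <;> linarith
      · simp only [hcol _ j' hj']; exact h.column j' n
    · intro u j' hz
      dsimp only at hz
      rcases eq_or_ne j' j with rfl | hj'
      · rcases eq_or_ne u (t + 1) with rfl | hu1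
        · rw [Function.update_self]
        · rw [Function.update_of_ne hu1]
          have : u = t := by
            by_contra hu
            exact hz (by rw [hcolj, if_neg hu, if_neg hu1, add_zero])
          rw [this]; exact haj
      · rw [hcol u j' hj'] at hz
        -- Overwriting `a (t + 1)` is harmless: that bucket was empty before.
        have hu1 : u ≠ t + 1 := by rintro rfl; exact hz (hfut j')
        rw [Function.update_of_ne hu1]
        exact h.upper u j' hz
    · intro u hu j' hz
      dsimp only at hu hz
      rcases eq_or_ne u t with rfl | hut
      · rw [Function.update_self]
        rcases eq_or_ne j' j with rfl | hj'
        · exact le_rfl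
        · rw [hcol u j' hj'] at hz
          exact h.unprocessed_le_current j (by simp) j' hz
      · rw [Function.update_of_ne (by omega)]
        rw [hrow' u hut (by omega)] at hz
        exact h.lower u (by dsimp only; omega) j' hz
    · intro j' hj' u
      dsimp only
      rw [hcol u j' (hne j' hj')]; exact h.unprocessed j' (by simp [hj']) u
    · intro j' hj'
      dsimp only
      rw [Function.update_self]; exact hl j' hj'
    · intro j' hj' i hz
      dsimp only at hz
      rcases eq_or_ne i j with rfl | hi
      · exact hl j' hj'
      · exact absurd (by rw [hcol _ i hi, hfut]) hz
    · intro u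
      rcases eq_or_ne u (t + 1) with rfl | hu1
      · rw [Function.update_self]; exact hp j
      · rw [Function.update_of_ne hu1]; exact h.bound_nonneg u

theorem FillInvariant.foldl {p x : J → ℝ} (hp : ∀ j, 0 ≤ p j) (hx : ∀ j, 0 ≤ x j)
    (hx1 : ∀ j, x j ≤ 1) {l : List J} (hnd : l.Nodup)
    (hl : l.Pairwise fun j j' => p j' ≤ p j) {s : ℕ × (ℕ → J → ℝ)} {a : ℕ → ℝ}
    (h : FillInvariant p x l s a) : ∃ a', FillInvariant p x [] (l.foldl (fillStep x) s) a' := by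
  induction l generalizing s a with
  | nil => exact ⟨a, h⟩
  | cons j l ih =>
    rw [List.nodup_cons] at hnd
    rw [List.pairwise_cons] at hl
    obtain ⟨a', h'⟩ := h.step hp hx hx1 hnd.1 hl.1
    exact ih hnd.2 hl.2 h'

/-- The buckets are filled in the order of the sizes: `a t` bounds bucket `t` from above and
`a (t + 1)` bounds it from below, and `a (t + 1) = 0` unless bucket `t` is full. -/
theorem exists_bucket_bounds {p x : J → ℝ} (hp : ∀ j, 0 ≤ p j) (hx : ∀ j, 0 ≤ x j)
    (hx1 : ∀ j, x j ≤ 1) {l : List J} (hnd : l.Nodup)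
    (hl : l.Pairwise fun j j' => p j' ≤ p j) :
    (∀ j n, ∑ t ∈ Finset.range n, fillBuckets x l t j ≤ x j) ∧
    ∃ a : ℕ → ℝ, (∀ t, 0 ≤ a t) ∧ (∀ t j, fillBuckets x l t j ≠ 0 → p j ≤ a t) ∧
      (∀ t j, fillBuckets x l t j ≠ 0 → a (t + 1) ≤ p j) ∧
      ∀ t, ∑ j, fillBuckets x l t j = 1 ∨ a (t + 1) = 0 := by
  obtain ⟨a, h⟩ := (FillInvariant.initial hp hx l).foldl hp hx hx1 hnd hl
  obtain ⟨T, hT⟩ : ∃ T, T = (l.foldl (fillStep x) (0, fun _ _ => 0)).1 := ⟨_, rfl⟩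
  -- The last bucket `T` may be only partly filled, hence possibly unmatched, so its lower bound `a
  -- (T + 1)` is reset to `0`.
  refine ⟨h.column, fun t => if t ≤ T then a t else 0, ?_, ?_, ?_, ?_⟩
  · intro t; dsimp only; split_ifs; exacts [h.bound_nonneg t, le_rfl]
  · intro t j hz
    have ht : t ≤ T := by
      by_contra ht
      exact hz (h.future t (by omega) j)
    dsimp only
    rw [if_pos ht]; exact h.upper t j hz
  · intro t j hz
    dsimp only
    split_ifs with ht
    · exact h.lower t (by omega) j hz
    · exact hp j
  · intro t
    by_cases ht : t + 1 ≤ T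
    · exact .inl (h.full t (by omega))
    · exact .inr (if_neg ht)

end UniformSmith
-- Costs, marginals and the lower bound for the input.
namespace UniformSmith

theorem IsIntegralMatching.nonneg {B J : Type*} [Fintype B] [Fintype J] {m : B → J → ℝ}
    (hm : IsIntegralMatching m) (u : B) (j : J) : 0 ≤ m u j := by
  rcases hm.zero_or_one u j with h | h <;> rw [h]
  exact zero_le_one

variable {M J : Type*} [DecidableEq J]

/-- The sum over ordered pairs, doubled, completes one copy of the squares to the square of the
load. -/
theorem two_mul_cost (I : SchedInstance M J) (C : Finset J) :
    2 * cost I C = (∑ j ∈ C, I.p j) ^ 2 + ∑ j ∈ C, I.p j ^ 2 := by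
  have h : ∀ j ∈ C, ∑ j' ∈ C.erase j, I.p j * I.p j' / 2
      = I.p j * (∑ j' ∈ C, I.p j') / 2 - I.p j ^ 2 / 2 := fun j hj => by
    rw [← Finset.add_sum_erase C I.p hj, ← Finset.sum_div, ← Finset.mul_sum]
    ring
  rw [cost, Finset.sum_congr rfl h, Finset.sum_sub_distrib, ← Finset.sum_div, ← Finset.sum_div,
    ← Finset.sum_mul]
  ring

theorem cost_empty (I : SchedInstance M J) : cost I ∅ = 0 := by simp [cost]

theorem marginal_nonneg [Fintype M] [Fintype J] {I : SchedInstance M J} {y : M → Finset J → ℝ}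
    (hy : IsConfigLPSolution I y) (i : M) (j : J) : 0 ≤ marginal I y i j :=
  Finset.sum_nonneg fun C hC =>
    hy.nonneg i C (Finset.mem_powerset.1 (Finset.mem_filter.1 hC).1)

variable [Fintype J]

theorem sum_inputDist_mul_cost (I : SchedInstance M J) (y : M → Finset J → ℝ) (i : M) :
    ∑ C, inputDist I y i C * cost I C = ∑ C ∈ (I.eligible i).powerset, y i C * cost I C := by
  simp only [inputDist, add_mul, Finset.sum_add_distrib, ite_mul, zero_mul, Finset.sum_ite_eq',
    Finset.mem_univ, if_true, cost_empty, mul_zero, add_zero]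
  rw [← Finset.sum_filter]
  congr 1
  ext C
  simp

theorem sum_mul_sum_eq_sum_marginal_mul (I : SchedInstance M J) (y : M → Finset J → ℝ) (i : M)
    (g : J → ℝ) :
    ∑ C ∈ (I.eligible i).powerset, y i C * ∑ j ∈ C, g j = ∑ j, marginal I y i j * g j := by
  simp only [marginal, Finset.sum_filter, Finset.sum_mul, ite_mul, zero_mul]
  rw [Finset.sum_comm]
  refine Finset.sum_congr rfl fun C _ => ?_
  rw [Finset.mul_sum, ← Finset.sum_filter]
  congr 1
  ext j
  simp

theorem sum_sq_le_sq_sum {ι : Type*} (C : Finset ι) {g : ι → ℝ} (hg : ∀ j, 0 ≤ g j) :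
    ∑ j ∈ C, g j ^ 2 ≤ (∑ j ∈ C, g j) ^ 2 := by
  rw [sq (∑ j ∈ C, g j), Finset.sum_mul]
  exact Finset.sum_le_sum fun j hj => by
    rw [sq]
    exact mul_le_mul_of_nonneg_left (Finset.single_le_sum (fun j _ => hg j) hj) (hg j)

/-- The claim is `∑ max(p_j - w, 0)² ≤ (∑ p_j - w)²`. If some job exceeds `w`, that job alone
absorbs the subtracted `w`, so the excesses sum to at most `∑ p_j - w`; otherwise the left side is
`0`. -/
theorem sq_sum_lower_bound {ι : Type*} (C : Finset ι) {p : ι → ℝ} (hp : ∀ j, 0 ≤ p j) {w : ℝ}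
    (hw : 0 ≤ w) :
    2 * w * ∑ j ∈ C, p j - w ^ 2 + ∑ j ∈ C, max (p j - w) 0 ^ 2 ≤ (∑ j ∈ C, p j) ^ 2 := by
  have hmax : ∀ j, 0 ≤ max (p j - w) 0 := fun j => le_max_right _ _
  have h1 := sum_sq_le_sq_sum C hmax
  rcases Finset.eq_empty_or_nonempty {j ∈ C | w < p j} with h | ⟨j₀, hj₀⟩
  · have h0 : ∑ j ∈ C, max (p j - w) 0 ^ 2 = 0 := Finset.sum_eq_zero fun j hj => by
      have : ¬ w < p j := fun hlt => by
        have : j ∈ ({j ∈ C | w < p j} : Finset ι) := Finset.mem_filter.2 ⟨hj, hlt⟩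
        simp [h] at this
      rw [max_eq_right (by linarith)]; norm_num
    rw [h0]
    nlinarith [sq_nonneg (∑ j ∈ C, p j - w)]
  · obtain ⟨hj, hlt⟩ := Finset.mem_filter.1 hj₀
    have h2 : ∑ j ∈ C, max (p j - w) 0 ≤ ∑ j ∈ C, p j - w := by
      classical
      rw [← Finset.add_sum_erase C p hj, ← Finset.add_sum_erase C _ hj, max_eq_left (by linarith)]
      have : ∑ j ∈ C.erase j₀, max (p j - w) 0 ≤ ∑ j ∈ C.erase j₀, p j :=
        Finset.sum_le_sum fun j _ => max_le (by linarith) (hp j)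
      linarith
    have h3 : 0 ≤ ∑ j ∈ C, max (p j - w) 0 := Finset.sum_nonneg fun j _ => hmax j
    nlinarith

theorem marginal_le_one [Fintype M] {I : SchedInstance M J} {y : M → Finset J → ℝ}
    (hy : IsConfigLPSolution I y) (i : M) (j : J) : marginal I y i j ≤ 1 := by
  rw [← hy.job j]
  exact Finset.single_le_sum (fun i _ => marginal_nonneg hy i j) (Finset.mem_univ i)

/-- A lower bound on the cost of the input distribution in terms of its marginals. -/
theorem marginals_le_two_mul_input_cost [Fintype M] {I : SchedInstance M J}
    {y : M → Finset J → ℝ} (hy : IsConfigLPSolution I y) (i : M) {w : ℝ} (hw : 0 ≤ w) :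
    2 * w * ∑ j, marginal I y i j * I.p j - w ^ 2
        + ∑ j, marginal I y i j * max (I.p j - w) 0 ^ 2 + ∑ j, marginal I y i j * I.p j ^ 2
      ≤ 2 * ∑ C, inputDist I y i C * cost I C := by
  rw [sum_inputDist_mul_cost, ← sum_mul_sum_eq_sum_marginal_mul,
    ← sum_mul_sum_eq_sum_marginal_mul I y i fun j => max (I.p j - w) 0 ^ 2,
    ← sum_mul_sum_eq_sum_marginal_mul I y i fun j => I.p j ^ 2]
  have h : ∑ C ∈ (I.eligible i).powerset, y i C * (2 * w * ∑ j ∈ C, I.p j - w ^ 2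
      + ∑ j ∈ C, max (I.p j - w) 0 ^ 2 + ∑ j ∈ C, I.p j ^ 2)
      ≤ ∑ C ∈ (I.eligible i).powerset, y i C * (2 * cost I C) :=
    Finset.sum_le_sum fun C hC => by
      refine mul_le_mul_of_nonneg_left ?_ (hy.nonneg i C (Finset.mem_powerset.1 hC))
      rw [two_mul_cost]
      linarith [sq_sum_lower_bound C I.p_nonneg hw]
  -- The constant `-w²` is weighted by the total mass, which is at most `1`.
  have h1 := mul_le_mul_of_nonneg_right (hy.machine i) (sq_nonneg w)
  simp only [mul_add, mul_sub, Finset.sum_add_distrib, Finset.sum_sub_distrib, mul_left_comm _ (2 * w),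
    mul_left_comm _ (2 : ℝ), ← Finset.mul_sum, ← Finset.sum_mul] at h
  linarith

theorem sum_outputDist_mul {I : SchedInstance M J} {y : M → Finset J → ℝ} {K : ℕ}
    (lam : Fin K → ℝ) (m : Fin K → Bucket I y → J → ℝ) (i : M) (g : Finset J → ℝ) :
    ∑ C, outputDist lam m i C * g C = ∑ k, lam k * g (assignedJobs (m k) i) := by
  simp only [outputDist, Finset.sum_mul, ite_mul, zero_mul]
  rw [Finset.sum_comm]
  simp

/-- The functions `g` are quantified inside the alternative, so that one matched job evaluates both
the sizes and functions of them. -/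
theorem IsIntegralMatching.row {B : Type*} [Fintype B] {m : B → J → ℝ}
    (hm : IsIntegralMatching m) (u : B) :
    (∀ g : J → ℝ, ∑ j, m u j * g j = 0) ∨
      ∃ j, m u j = 1 ∧ ∀ g : J → ℝ, ∑ j', m u j' * g j' = g j := by
  by_cases h : ∃ j, m u j = 1
  · obtain ⟨j, hj⟩ := h
    refine .inr ⟨j, hj, fun g => ?_⟩
    have hz : ∀ j' ∈ Finset.univ.erase j, m u j' = 0 := by
      have h1 := hm.left u
      rw [← Finset.add_sum_erase _ _ (Finset.mem_univ j), hj] at h1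
      exact (Finset.sum_eq_zero_iff_of_nonneg fun j' _ => hm.nonneg u j').1
        (le_antisymm (by linarith) (Finset.sum_nonneg fun j' _ => hm.nonneg u j'))
    rw [← Finset.add_sum_erase _ _ (Finset.mem_univ j), hj, one_mul,
      Finset.sum_eq_zero fun j' hj' => by rw [hz j' hj', zero_mul], add_zero]
  · refine .inl fun g => Finset.sum_eq_zero fun j _ => ?_
    rw [(hm.zero_or_one u j).resolve_right fun hj => h ⟨j, hj⟩, zero_mul]

theorem sum_assignedJobs [Fintype M] {I : SchedInstance M J} {y : M → Finset J → ℝ}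
    {m : Bucket I y → J → ℝ} (hm : IsIntegralMatching m) (i : M) (g : J → ℝ) :
    ∑ j ∈ assignedJobs m i, g j = ∑ t : Fin (numBuckets I y i), ∑ j, m ⟨i, t⟩ j * g j := by
  classical
  rw [Finset.sum_comm, assignedJobs, Finset.sum_filter]
  refine Finset.sum_congr rfl fun j _ => ?_
  rw [← Finset.sum_mul]
  split_ifs with h
  · obtain ⟨t, ht⟩ := h
    have h1 : ∑ t, m ⟨i, t⟩ j ≤ 1 := by
      refine le_trans ?_ (hm.right j)
      rw [Fintype.sum_sigma]
      exact Finset.single_le_sum (f := fun i => ∑ t, m ⟨i, t⟩ j)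
        (fun i _ => Finset.sum_nonneg fun t _ => hm.nonneg _ j) (Finset.mem_univ i)
    have h2 : m ⟨i, t⟩ j ≤ ∑ t, m ⟨i, t⟩ j := Finset.single_le_sum
      (f := fun t => m ⟨i, t⟩ j) (fun t _ => hm.nonneg _ j) (Finset.mem_univ t)
    rw [le_antisymm h1 (ht ▸ h2), one_mul]
  · rw [Finset.sum_eq_zero fun t _ =>
      (hm.zero_or_one ⟨i, t⟩ j).resolve_right fun ht => h ⟨t, ht⟩, zero_mul]

/-- Pair each `X (t + 1)` with the subtracted `a (t + 1)`: only the first `X` and the last `a`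
survive. -/
theorem sum_sub_le_head {n : ℕ} (hn : 0 < n) {a : ℕ → ℝ} {X : Fin n → ℝ} (hX : ∀ t, X t ≤ a t) :
    ∑ t, (X t - a (t + 1)) ≤ X ⟨0, hn⟩ - a n := by
  induction n, hn using Nat.le_induction with
  | base => simp
  | succ n hn ih =>
    rw [Fin.sum_univ_castSucc]
    have h1 := ih (X := fun t => X t.castSucc) fun t => hX t.castSucc
    have h2 := hX (Fin.last n)
    simp only [Fin.val_castSucc, Fin.val_last, Fin.castSucc_mk] at h1 h2 ⊢
    linarith

/-! ### What every sampled matching inherits from the fractional one. -/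

section Decomposition

variable {B J : Type*} [Fintype B] [Fintype J] {z : B → J → ℝ} {K : ℕ} {lam : Fin K → ℝ}
  {m : Fin K → B → J → ℝ}

theorem IsMatchingDecomposition.sum_row (hm : IsMatchingDecomposition z lam m) (u : B)
    (g : J → ℝ) : ∑ k, lam k * ∑ j, m k u j * g j = ∑ j, z u j * g j := by
  simp only [hm.combination, Finset.sum_mul, Finset.mul_sum]
  rw [Finset.sum_comm]
  simp only [mul_assoc]

theorem IsMatchingDecomposition.ne_zero_of_eq_one (hm : IsMatchingDecomposition z lam m)
    {k : Fin K} (hk : lam k ≠ 0) {u : B} {j : J} (h : m k u j = 1) : z u j ≠ 0 := by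
  have h1 : lam k * m k u j ≤ z u j := by
    rw [hm.combination]
    exact Finset.single_le_sum (f := fun k => lam k * m k u j)
      (fun k _ => mul_nonneg (hm.nonneg k) ((hm.matching k).nonneg u j)) (Finset.mem_univ k)
  have h2 : 0 < lam k := (hm.nonneg k).lt_of_ne' hk
  rw [h, mul_one] at h1
  linarith

/-- An average of numbers at most `1` equals `1` only if each number of positive weight does. -/
theorem IsMatchingDecomposition.row_sum_eq_one (hm : IsMatchingDecomposition z lam m)
    {k : Fin K} (hk : lam k ≠ 0) {u : B} (h : ∑ j, z u j = 1) : ∑ j, m k u j = 1 := by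
  have h1 : ∑ k, lam k * (1 - ∑ j, m k u j) = 0 := by
    have := hm.sum_row u fun _ => 1
    simp only [mul_one] at this
    simp only [mul_sub, mul_one, Finset.sum_sub_distrib]
    rw [this, h, hm.sum_eq_one, sub_self]
  have h2 := (Finset.sum_eq_zero_iff_of_nonneg fun k _ =>
    mul_nonneg (hm.nonneg k) (sub_nonneg.2 ((hm.matching k).left u))).1 h1 k (Finset.mem_univ k)
  linarith [(mul_eq_zero.1 h2).resolve_left hk]

end Decomposition

/-! ### The load produced by the rounding. -/

section Rounding

variable [Fintype M] {I : SchedInstance M J} {y : M → Finset J → ℝ} {L : M → List J} {K : ℕ}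
  {lam : Fin K → ℝ} {m : Fin K → Bucket I y → J → ℝ}

theorem sum_assignedJobs_le_marginals (hy : IsConfigLPSolution I y)
    (hL : ∀ i, IsSizeOrder I (L i)) (hm : IsMatchingDecomposition (fracMatching I y L) lam m)
    (i : M) {g : J → ℝ} (hg : ∀ j, 0 ≤ g j) :
    ∑ k, lam k * ∑ j ∈ assignedJobs (m k) i, g j ≤ ∑ j, marginal I y i j * g j := by
  obtain ⟨hcol, -⟩ := exists_bucket_bounds I.p_nonneg (marginal_nonneg hy i)
    (marginal_le_one hy i) (hL i).nodup (hL i).sorted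
  simp only [sum_assignedJobs (hm.matching _), Finset.mul_sum (Finset.univ (α := Fin (numBuckets I y i)))]
  rw [Finset.sum_comm]
  simp only [hm.sum_row]
  rw [Finset.sum_comm]
  refine Finset.sum_le_sum fun j _ => ?_
  rw [← Finset.sum_mul]
  refine mul_le_mul_of_nonneg_right ?_ (hg j)
  exact (Finset.sum_range fun t => fillBuckets (marginal I y i) (L i) t j).symm.trans_le (hcol j _)

/-- Up to a constant, the total size of the jobs scheduled on `i` is a nonnegative random variable
that is bounded by the size of the job matched to the first bucket. -/
theorem exists_excess (hy : IsConfigLPSolution I y) (hL : ∀ i, IsSizeOrder I (L i))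
    (hm : IsMatchingDecomposition (fracMatching I y L) lam m) (i : M) :
    ∃ (b : ℝ) (D : Fin K → ℝ), 0 ≤ b ∧ (∀ k, 0 ≤ D k) ∧
      (∀ k, lam k ≠ 0 → ∑ j ∈ assignedJobs (m k) i, I.p j = b + D k) ∧
      ∀ h : ℝ → ℝ, h 0 = 0 → (∀ x x', 0 ≤ x → x ≤ x' → h x ≤ h x') →
        ∑ k, lam k * h (D k) ≤ ∑ j, marginal I y i j * h (I.p j) := by
  obtain ⟨hcol, a, ha0, hup, hlow, hfull⟩ := exists_bucket_bounds I.p_nonneg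
    (marginal_nonneg hy i) (marginal_le_one hy i) (hL i).nodup (hL i).sorted
  have hfrac : ∀ t j, fracMatching I y L ⟨i, t⟩ j = fillBuckets (marginal I y i) (L i) t j :=
    fun _ _ => rfl
  have hXup : ∀ k, lam k ≠ 0 → ∀ t : Fin (numBuckets I y i),
      ∑ j, m k ⟨i, t⟩ j * I.p j ≤ a t := fun k hk t => by
    rcases (hm.matching k).row ⟨i, t⟩ with h | ⟨j, hj, h⟩
    · rw [h]; exact ha0 t
    · rw [h]; exact hup t j (hfrac t j ▸ hm.ne_zero_of_eq_one hk hj)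
  have hXlow : ∀ k, lam k ≠ 0 → ∀ t : Fin (numBuckets I y i),
      a (t + 1) ≤ ∑ j, m k ⟨i, t⟩ j * I.p j := fun k hk t => by
    rcases (hm.matching k).row ⟨i, t⟩ with h | ⟨j, hj, h⟩
    -- An unmatched bucket cannot be full, so its lower bound is `0`.
    · rw [h]
      rcases hfull t with ht | ht
      · simp only [← hfrac] at ht
        have h1 := hm.row_sum_eq_one hk ht
        have h2 := h fun _ => 1
        simp only [mul_one, h1] at h2
        exact absurd h2 one_ne_zero
      · exact ht.le
    · rw [h]; exact hlow t j (hfrac t j ▸ hm.ne_zero_of_eq_one hk hj)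
  obtain ⟨b, hb⟩ : ∃ b, b = ∑ t : Fin (numBuckets I y i), a (t + 1) := ⟨_, rfl⟩
  have hsub : ∀ k, ∑ j ∈ assignedJobs (m k) i, I.p j - b
      = ∑ t : Fin (numBuckets I y i), (∑ j, m k ⟨i, t⟩ j * I.p j - a (t + 1)) := fun k => by
    rw [sum_assignedJobs (hm.matching k), hb, Finset.sum_sub_distrib]
  have hpos : ∀ k, lam k ≠ 0 → 0 ≤ ∑ j ∈ assignedJobs (m k) i, I.p j - b := fun k hk => by
    rw [hsub]
    exact Finset.sum_nonneg fun t _ => sub_nonneg.2 (hXlow k hk t)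
  -- Truncation at `0` matters only for matchings of probability `0`, about which the bucket bounds
  -- say nothing.
  refine ⟨b, fun k => max (∑ j ∈ assignedJobs (m k) i, I.p j - b) 0,
    hb ▸ Finset.sum_nonneg fun t _ => ha0 _, fun k => le_max_right _ _, fun k hk => ?_,
    fun h h0 hmono => ?_⟩
  · dsimp only
    rw [max_eq_left (hpos k hk)]; ring
  · have hnn : ∀ x, 0 ≤ x → 0 ≤ h x := fun x hx => h0 ▸ hmono 0 x le_rfl hx
    rcases Nat.eq_zero_or_pos (numBuckets I y i) with hn | hn
    · refine le_trans (Finset.sum_nonpos fun k _ => ?_) (Finset.sum_nonneg fun j _ =>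
        mul_nonneg (marginal_nonneg hy i j) (hnn _ (I.p_nonneg j)))
      have : IsEmpty (Fin (numBuckets I y i)) := by rw [hn]; infer_instance
      dsimp only
      rw [hsub, Finset.univ_eq_empty, Finset.sum_empty, max_self, h0, mul_zero]
    · have hX0 : ∀ k, lam k ≠ 0 → ∑ j ∈ assignedJobs (m k) i, I.p j - b
          ≤ ∑ j, m k ⟨i, ⟨0, hn⟩⟩ j * I.p j := fun k hk => by
        rw [hsub]
        have := sum_sub_le_head hn (hXup k hk)
        linarith [ha0 (numBuckets I y i)]
      have hle : ∀ k, lam k * h (max (∑ j ∈ assignedJobs (m k) i, I.p j - b) 0)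
          ≤ lam k * ∑ j, m k ⟨i, ⟨0, hn⟩⟩ j * h (I.p j) := fun k => by
        by_cases hk : lam k = 0
        · rw [hk, zero_mul, zero_mul]
        · refine mul_le_mul_of_nonneg_left ?_ (hm.nonneg k)
          have h1 := hX0 k hk
          rw [max_eq_left (hpos k hk)]
          -- If the first bucket is unmatched, the excess is squeezed to `0`, where `h` vanishes.
          rcases (hm.matching k).row ⟨i, ⟨0, hn⟩⟩ with hr | ⟨j, -, hr⟩
          · rw [hr] at h1 ⊢
            rw [le_antisymm h1 (hpos k hk), h0]
          · rw [hr] at h1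
            rw [hr fun j => h (I.p j)]
            exact hmono _ _ (hpos k hk) h1
      refine (Finset.sum_le_sum fun k _ => hle k).trans ?_
      rw [hm.sum_row ⟨i, ⟨0, hn⟩⟩ fun j => h (I.p j)]
      refine Finset.sum_le_sum fun j _ => mul_le_mul_of_nonneg_right ?_ (hnn _ (I.p_nonneg j))
      have := hcol j 1
      rwa [Finset.sum_range_one] at this

end Rounding

end UniformSmith

/-! ### Combination of the output and input bounds. -/

theorem theorem3 {M J : Type*} [Fintype M] [Fintype J] [DecidableEq J]
    (I : UniformSmith.SchedInstance M J)
    (y : M → Finset J → ℝ) (hy : UniformSmith.IsConfigLPSolution I y)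
    (L : M → List J) (hL : ∀ i, UniformSmith.IsSizeOrder I (L i))
    {K : ℕ} (lam : Fin K → ℝ) (m : Fin K → UniformSmith.Bucket I y → J → ℝ)
    (hm : UniformSmith.IsMatchingDecomposition (UniformSmith.fracMatching I y L) lam m)
    (i : M) :
    ∑ C : Finset J, UniformSmith.outputDist lam m i C * UniformSmith.cost I C ≤
      (1 + √2) / 2 *
        ∑ C : Finset J, UniformSmith.inputDist I y i C * UniformSmith.cost I C := by
  obtain ⟨b, D, hb, hD, hS, hmono⟩ := UniformSmith.exists_excess hy hL hm i
  obtain ⟨c, hc⟩ : ∃ c, c = (1 + √2) / 2 := ⟨_, rfl⟩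
  have hc1 : 1 ≤ c := by
    have : 1 ≤ √2 := Real.one_le_sqrt.2 (by norm_num)
    linarith
  obtain ⟨w, hw, hcore⟩ := UniformSmith.exists_second_moment_bound hc hm.nonneg hm.sum_eq_one hD hb
  have hin := UniformSmith.marginals_le_two_mul_input_cost hy i hw
  have hS' : ∀ F : ℝ → ℝ, ∑ k, lam k * F (∑ j ∈ UniformSmith.assignedJobs (m k) i, I.p j)
      = ∑ k, lam k * F (b + D k) := fun F => Finset.sum_congr rfl fun k _ => by
    by_cases hk : lam k = 0
    · rw [hk, zero_mul, zero_mul]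
    · rw [hS k hk]
  have hout : 2 * ∑ C, UniformSmith.outputDist lam m i C * UniformSmith.cost I C
      = ∑ k, lam k * (b + D k) ^ 2
        + ∑ k, lam k * ∑ j ∈ UniformSmith.assignedJobs (m k) i, I.p j ^ 2 := by
    rw [UniformSmith.sum_outputDist_mul, ← hS' fun x => x ^ 2, Finset.mul_sum,
      ← Finset.sum_add_distrib]
    exact Finset.sum_congr rfl fun k _ => by
      rw [mul_left_comm, UniformSmith.two_mul_cost, mul_add]
  have hQ := UniformSmith.sum_assignedJobs_le_marginals hy hL hm i fun j => sq_nonneg (I.p j)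
  have hmean := UniformSmith.sum_assignedJobs_le_marginals hy hL hm i I.p_nonneg
  rw [hS' fun x => x] at hmean
  have h1 := hmono (fun x => max (x - w) 0 ^ 2) (by simp [hw]) fun x x' _ hx =>
    pow_le_pow_left₀ (le_max_right _ _) (max_le_max_right 0 (by linarith)) 2
  have h2 := hmono (fun x => x ^ 2) (by simp) fun x x' h0 hx => pow_le_pow_left₀ h0 hx 2
  rw [← hc]
  -- Each moment of `D` and the mean load have a nonnegative coefficient in `hcore`, so all can be
  -- replaced by marginals before `hin` is applied.
  have e1 := mul_le_mul_of_nonneg_left hmean (by positivity : 0 ≤ c * (2 * w))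
  have e2 := mul_le_mul_of_nonneg_left h1 (by positivity : 0 ≤ c)
  have e3 := mul_le_mul_of_nonneg_left h2 (by linarith : 0 ≤ c - 1)
  have e4 := mul_le_mul_of_nonneg_left hin (by positivity : 0 ≤ c)
  linarith
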